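/- Let $\mathcal H$ be a complex Hilbert space with scalar product linear in the second entry. For a bounded operator $A$ on $\mathcal H$ put $|A|=(A^*A)^{1/2}$; for real $p\ge 1$ let $\mathcal B_p$ be the set of bounded operators $A$ with $\operatorname{tr}|A|^p<\infty$, and let $\|A\|_p=(\operatorname{tr}|A|^p)^{1/p}$ for $A\in\mathcal B_p$. A spectral decomposition of a bounded operator $A_0$ is a representation $A_0=\sum_{n\in I}\mu_n\,|u_n\rangle\langle u_n|$, convergent in operator norm, where $I=\{0,1,2,\dots\}$ is a finite or infinite initial segment of $\mathbb N$, $(u_n)_{n\in I}$ is an orthonormal family in $\mathcal H$, and the $\mu_n\in\mathbb C$ are nonzero (so that the $\mu_n$ are the nonzero eigenvalues of $A_0$, each repeated according to its multiplicity). Let $1<p<\infty$ and let $A_0,A\in\mathcal B_1$ with $A_0$ normal and $\|A_0\|_1=\|A\|_1=1$. Then $A_0-A\in\mathcal B_1$ and $A_0-A\in\mathcal B_p$, the operator $A_0$ has a spectral decomposition, and for every spectral decomposition $A_0=\sum_{n\in I}\mu_n\,|u_n\rangle\langle u_n|$ we have $\sum_{n\in I}|\mu_n|<\infty$ and $$\|A_0-A\|_1\le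 3\,N^{(p-1)/p}\,\|A_0-A\|_p+2\sum_{n\in I,\ n\ge N}|\mu_n|\qquad\text{for all } N\in\mathbb N=\{0,1,2,\dots\}.$$ -/

import Mathlib

open scoped ENNReal InnerProductSpace

noncomputable section

namespace Schatten

variable {H : Type*} [NormedAddCommGroup H] [InnerProductSpace ℂ H] [CompleteSpace H]

/-- The trace `∑ᵢ ⟨eᵢ, T eᵢ⟩ ∈ [0, ∞]` of a positive operator `T`, computed in the Hilbert basis
`e`. It is used for positive `T` only, where all the terms are nonnegative reals. -/
def traceIn {ι : Type*} (e : HilbertBasis ι ℂ H) (T : H →L[ℂ] H) : ℝ≥0∞ :=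
  ∑' i, ENNReal.ofReal (RCLike.re ⟪e i, T (e i)⟫_ℂ)

theorem traceIn_eq_tsum_tsum {ι κ : Type*} (e : HilbertBasis ι ℂ H) (f : HilbertBasis κ ℂ H)
    {T : H →L[ℂ] H} (hT : 0 ≤ T) :
    traceIn e T = ∑' i, ∑' j, ENNReal.ofReal (‖⟪CFC.sqrt T (e i), f j⟫_ℂ‖ ^ 2) := by
  have hs : ∀ x y : H, ⟪CFC.sqrt T x, y⟫_ℂ = ⟪x, CFC.sqrt T y⟫_ℂ := by
    have := ((ContinuousLinearMap.nonneg_iff_isPositive _).1 (CFC.sqrt_nonneg T)).isSymmetric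
    exact fun x y => this x y
  unfold traceIn
  refine tsum_congr fun i => ?_
  have h1 : T (e i) = CFC.sqrt T (CFC.sqrt T (e i)) := by
    conv_lhs => rw [← CFC.sqrt_mul_sqrt_self T hT]
    rfl
  rw [h1, ← hs, inner_self_eq_norm_sq (𝕜 := ℂ)]
  have h2 := f.hasSum_inner_mul_inner (CFC.sqrt T (e i)) (CFC.sqrt T (e i))
  have h3 : HasSum (fun j => ‖⟪CFC.sqrt T (e i), f j⟫_ℂ‖ ^ 2) (‖CFC.sqrt T (e i)‖ ^ 2) := by
    have h4 := RCLike.hasSum_re ℂ h2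
    rw [inner_self_eq_norm_sq (𝕜 := ℂ)] at h4
    convert h4 using 2 with j
    rw [inner_mul_symm_re_eq_norm, norm_mul, norm_inner_symm (f j), sq]
  rw [← h3.tsum_eq, ENNReal.ofReal_tsum_of_nonneg (fun _ => by positivity) h3.summable]

/-- The trace of a positive operator does not depend on the Hilbert basis. -/
theorem traceIn_eq {ι κ : Type*} (e : HilbertBasis ι ℂ H) (f : HilbertBasis κ ℂ H)
    {T : H →L[ℂ] H} (hT : 0 ≤ T) : traceIn e T = traceIn f T := by
  have hs : ∀ x y : H, ⟪CFC.sqrt T x, y⟫_ℂ = ⟪x, CFC.sqrt T y⟫_ℂ := by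
    have := ((ContinuousLinearMap.nonneg_iff_isPositive _).1 (CFC.sqrt_nonneg T)).isSymmetric
    exact fun x y => this x y
  rw [traceIn_eq_tsum_tsum e f hT, traceIn_eq_tsum_tsum f e hT, ENNReal.tsum_comm]
  refine tsum_congr fun j => tsum_congr fun i => ?_
  rw [hs, norm_inner_symm]

/-- The trace in `[0, ∞]` of a positive operator: its trace in any Hilbert basis. -/
def posTrace (T : H →L[ℂ] H) : ℝ≥0∞ :=
  traceIn (exists_hilbertBasis ℂ H).choose_spec.choose T

theorem posTrace_eq {ι : Type*} (e : HilbertBasis ι ℂ H) {T : H →L[ℂ] H} (hT : 0 ≤ T) :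
    posTrace T = traceIn e T :=
  traceIn_eq _ e hT

/-- Membership in the Schatten ideal: `tr |A|^p < ∞`, where `|A| = (A* A)^{1/2}` and the power is
taken in the continuous functional calculus. For `p = 1` these are the trace-class operators. -/
def MemSchatten (p : ℝ) (A : H →L[ℂ] H) : Prop :=
  posTrace (CFC.abs A ^ p) < ∞

/-- The Schatten norm `‖A‖_p = (tr |A|^p)^{1/p}` of an operator with `tr |A|^p < ∞`. -/
def schattenNorm (p : ℝ) (A : H →L[ℂ] H) : ℝ :=
  (posTrace (CFC.abs A ^ p)).toReal ^ (1 / p)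

/-- `A = ∑_{n ∈ I} μ n |u n⟩⟨u n|` is a spectral decomposition of `A`: the index set `I` is an
initial segment of `ℕ` (finite or all of `ℕ`), the `u n` are orthonormal, the `μ n` are nonzero and
the series converges to `A` in operator norm. Then the `μ n` are the nonzero eigenvalues of `A`,
each repeated according to its multiplicity. -/
structure IsSpectralDecomposition (A : H →L[ℂ] H) (I : Set ℕ) (μ : I → ℂ) (u : I → H) :
    Prop where
  isLowerSet : IsLowerSet I
  orthonormal : Orthonormal ℂ u
  ne_zero : ∀ n, μ n ≠ 0
  hasSum : HasSum (fun n => μ n • InnerProductSpace.rankOne ℂ (u n) (u n)) A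

end Schatten

end

/-!
The trace norm `‖X‖₁` is the supremum of `∑ᵢ |⟨fᵢ, X eᵢ⟩|` over pairs of Bessel families `e`, `f`.
This makes it subadditive, and it gives the pinching inequality
`‖P X P‖₁ + ‖(1 - P) X (1 - P)‖₁ ≤ ‖X‖₁` for every orthogonal projection `P`.

Let `P` be the projection onto the span of the first `N` eigenvectors of `A₀`, and put `Q = 1 - P`,
`D = A₀ - A`. As `P` commutes with `A₀`, `D = P D + Q D P + Q A₀ - Q A Q`. The operators `P D`,
`Q D P` and `P D P` have rank at most `N`, so by Hölder's inequality their trace norms are at most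
`N ^ ((p - 1) / p) ‖D‖ₚ`, and `‖Q A₀‖₁` is at most the tail `∑_{n ≥ N} |μₙ|`. Finally
`‖Q A Q‖₁ ≤ ‖A‖₁ - ‖P A P‖₁ ≤ ‖A₀‖₁ - ‖P A P‖₁ ≤ ‖P D P‖₁ + ‖Q A₀‖₁`.
-/

namespace Schatten

section Bessel

variable {𝕜 H ι κ : Type*} [RCLike 𝕜] [NormedAddCommGroup H] [InnerProductSpace 𝕜 H]

variable (𝕜) in
/-- A family of vectors satisfying Bessel's inequality `∑ᵢ |⟨eᵢ, x⟩|² ≤ ‖x‖²`. The trace norm is a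
supremum over such families; unlike orthonormal families they are stable under contractions. -/
def IsBessel (e : ι → H) : Prop :=
  ∀ x : H, ∑' i, ‖⟪e i, x⟫_𝕜‖ₑ ^ 2 ≤ ‖x‖ₑ ^ 2

theorem tsum_mul_le_rpow_mul_rpow (a b : ι → ℝ≥0∞) :
    ∑' i, a i * b i ≤ (∑' i, a i ^ 2) ^ (1 / 2 : ℝ) * (∑' i, b i ^ 2) ^ (1 / 2 : ℝ) := by
  rw [ENNReal.tsum_eq_iSup_sum]
  refine iSup_le fun s => (ENNReal.inner_le_Lp_mul_Lq s a b .two_two).trans ?_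
  simp only [ENNReal.rpow_ofNat]
  gcongr <;> exact ENNReal.sum_le_tsum s

theorem sq_rpow_half (a : ℝ≥0∞) : (a ^ 2) ^ (1 / 2 : ℝ) = a := by
  rw [← ENNReal.rpow_natCast_mul]
  norm_num

theorem enorm_sq_eq_ofReal_norm_sq (x : H) : ‖x‖ₑ ^ 2 = ENNReal.ofReal (‖x‖ ^ 2) := by
  rw [← ofReal_norm, ENNReal.ofReal_pow (norm_nonneg x)]

theorem enorm_inner_comm (x y : H) : ‖⟪x, y⟫_𝕜‖ₑ = ‖⟪y, x⟫_𝕜‖ₑ := by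
  rw [← ofReal_norm, norm_inner_symm, ofReal_norm]

theorem tsum_enorm_inner_hilbertBasis_sq (b : HilbertBasis ι 𝕜 H) (x : H) :
    ∑' i, ‖⟪b i, x⟫_𝕜‖ₑ ^ 2 = ‖x‖ₑ ^ 2 := by
  have hsum : HasSum (fun i => ‖⟪b i, x⟫_𝕜‖ ^ 2) (‖x‖ ^ 2) := by
    convert RCLike.hasSum_re 𝕜 (b.hasSum_inner_mul_inner x x) using 2 with i
    · rw [inner_mul_symm_re_eq_norm, norm_mul, norm_inner_symm x, sq]
    · rw [inner_self_eq_norm_sq]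
  simp only [enorm_sq_eq_ofReal_norm_sq]
  rw [← hsum.tsum_eq, ENNReal.ofReal_tsum_of_nonneg (fun _ => by positivity) hsum.summable]

theorem enorm_opNorm_le_tsum_hilbertBasis {E : Type*} [NormedAddCommGroup E] [NormedSpace 𝕜 E]
    (b : HilbertBasis ι 𝕜 H) (X : H →L[𝕜] E) :
    ‖X‖ₑ ≤ (∑' i, ‖X (b i)‖ₑ ^ 2) ^ (1 / 2 : ℝ) := by
  refine X.opENorm_le_bound fun x => ?_
  have hx : HasSum (fun i => ⟪b i, x⟫_𝕜 • X (b i)) (X x) := by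
    simpa [b.repr_apply_apply] using (b.hasSum_repr x).mapL X
  calc ‖X x‖ₑ ≤ ∑' i, ‖⟪b i, x⟫_𝕜 • X (b i)‖ₑ := hx.tsum_eq ▸ enorm_tsum_le_tsum_enorm
    _ = ∑' i, ‖X (b i)‖ₑ * ‖⟪b i, x⟫_𝕜‖ₑ := by simp only [enorm_smul, mul_comm]
    _ ≤ (∑' i, ‖X (b i)‖ₑ ^ 2) ^ (1 / 2 : ℝ) * (∑' i, ‖⟪b i, x⟫_𝕜‖ₑ ^ 2) ^ (1 / 2 : ℝ) :=
      tsum_mul_le_rpow_mul_rpow _ _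
    _ = (∑' i, ‖X (b i)‖ₑ ^ 2) ^ (1 / 2 : ℝ) * ‖x‖ₑ := by
      rw [tsum_enorm_inner_hilbertBasis_sq, sq_rpow_half]

theorem isBessel_of_orthonormal {e : ι → H} (he : Orthonormal 𝕜 e) : IsBessel 𝕜 e := by
  intro x
  simp only [enorm_sq_eq_ofReal_norm_sq]
  rw [← ENNReal.ofReal_tsum_of_nonneg (fun _ => by positivity) (he.inner_products_summable x)]
  exact ENNReal.ofReal_le_ofReal (he.tsum_inner_products_le x)

theorem IsBessel.norm_le_one {e : ι → H} (he : IsBessel 𝕜 e) (i : ι) : ‖e i‖ ≤ 1 := by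
  have h : (‖e i‖ ^ 2) ^ 2 ≤ ‖e i‖ ^ 2 := by
    have h := (ENNReal.le_tsum i).trans (he (e i))
    rwa [enorm_sq_eq_ofReal_norm_sq, enorm_sq_eq_ofReal_norm_sq,
      ENNReal.ofReal_le_ofReal_iff (by positivity), inner_self_eq_norm_sq_to_K, norm_pow,
      RCLike.norm_ofReal, abs_norm] at h
  by_contra! hlt
  nlinarith [one_lt_pow₀ hlt two_ne_zero]

variable [CompleteSpace H]

theorem IsBessel.map {e : ι → H} (he : IsBessel 𝕜 e) {U : H →L[𝕜] H} (hU : ‖U‖ ≤ 1) :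
    IsBessel 𝕜 fun i => U (e i) := by
  intro x
  have hx : ‖star U x‖ₑ ≤ ‖x‖ₑ := by
    rw [← norm_star] at hU
    simpa [enorm_le_iff_norm_le] using (star U).le_of_opNorm_le hU x
  calc ∑' i, ‖⟪U (e i), x⟫_𝕜‖ₑ ^ 2 = ∑' i, ‖⟪e i, star U x⟫_𝕜‖ₑ ^ 2 := by
        simp only [ContinuousLinearMap.star_eq_adjoint, ContinuousLinearMap.adjoint_inner_right]
    _ ≤ ‖star U x‖ₑ ^ 2 := he _
    _ ≤ ‖x‖ₑ ^ 2 := by gcongr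

theorem inner_starProjection_left {P : H →L[𝕜] H} (hP : IsStarProjection P) (x y : H) :
    ⟪P x, y⟫_𝕜 = ⟪x, P y⟫_𝕜 :=
  hP.isSelfAdjoint.isSymmetric x y

theorem enorm_sq_add_enorm_sq_of_isStarProjection {P : H →L[𝕜] H} (hP : IsStarProjection P)
    (x : H) : ‖P x‖ₑ ^ 2 + ‖(1 - P) x‖ₑ ^ 2 = ‖x‖ₑ ^ 2 := by
  have horth : ⟪P x, (1 - P) x⟫_𝕜 = 0 := by
    rw [inner_starProjection_left hP, ← mul_apply_eq_comp, hP.isIdempotentElem.mul_one_sub_self,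
      zero_apply, inner_zero_right]
  have hpyth := norm_add_sq_eq_norm_sq_add_norm_sq_of_inner_eq_zero _ _ horth
  simp only [← pow_two, sub_apply, one_apply_eq_self, add_sub_cancel] at hpyth
  simp only [enorm_sq_eq_ofReal_norm_sq, sub_apply, one_apply_eq_self, hpyth]
  rw [ENNReal.ofReal_add (by positivity) (by positivity)]

theorem IsBessel.sumElim {P : H →L[𝕜] H} (hP : IsStarProjection P) {e : ι → H} {f : κ → H}
    (he : IsBessel 𝕜 e) (hf : IsBessel 𝕜 f) :
    IsBessel 𝕜 (Sum.elim (fun i => P (e i)) fun j => (1 - P) (f j)) := by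
  intro x
  rw [ENNReal.summable.tsum_sum ENNReal.summable,
    ← enorm_sq_add_enorm_sq_of_isStarProjection hP x]
  simp only [Sum.elim_inl, Sum.elim_inr, inner_starProjection_left hP,
    inner_starProjection_left hP.one_sub]
  exact add_le_add (he _) (hf _)

end Bessel

section PositiveTrace

variable {H : Type*} [NormedAddCommGroup H] [InnerProductSpace ℂ H]

theorem re_inner_nonneg {T : H →L[ℂ] H} (hT : 0 ≤ T) (x : H) : 0 ≤ RCLike.re ⟪x, T x⟫_ℂ :=
  ((ContinuousLinearMap.nonneg_iff_isPositive _).1 hT).re_inner_nonneg_right x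

variable [CompleteSpace H]

theorem re_inner_mono {S T : H →L[ℂ] H} (hST : S ≤ T) (x : H) :
    RCLike.re ⟪x, S x⟫_ℂ ≤ RCLike.re ⟪x, T x⟫_ℂ := by
  simpa [inner_sub_right] using re_inner_nonneg (sub_nonneg.2 hST) x

theorem inner_sqrt_left (T : H →L[ℂ] H) (x y : H) :
    ⟪CFC.sqrt T x, y⟫_ℂ = ⟪x, CFC.sqrt T y⟫_ℂ :=
  ((ContinuousLinearMap.nonneg_iff_isPositive _).1 (CFC.sqrt_nonneg T)).isSymmetric x y

theorem inner_sqrt_sqrt {T : H →L[ℂ] H} (hT : 0 ≤ T) (x y : H) :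
    ⟪CFC.sqrt T x, CFC.sqrt T y⟫_ℂ = ⟪x, T y⟫_ℂ := by
  rw [inner_sqrt_left, ← mul_apply_eq_comp, CFC.sqrt_mul_sqrt_self T hT]

theorem norm_sqrt_apply_sq {T : H →L[ℂ] H} (hT : 0 ≤ T) (x : H) :
    ‖CFC.sqrt T x‖ ^ 2 = RCLike.re ⟪x, T x⟫_ℂ := by
  rw [← inner_sqrt_sqrt hT, inner_self_eq_norm_sq (𝕜 := ℂ)]

theorem IsBessel.tsum_re_inner_le_posTrace {ι : Type*} {e : ι → H} (he : IsBessel ℂ e)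
    {T : H →L[ℂ] H} (hT : 0 ≤ T) :
    ∑' i, ENNReal.ofReal (RCLike.re ⟪e i, T (e i)⟫_ℂ) ≤ posTrace T := by
  obtain ⟨w, b, -⟩ := exists_hilbertBasis ℂ H
  rw [posTrace_eq b hT, traceIn]
  simp only [← norm_sqrt_apply_sq hT, ← enorm_sq_eq_ofReal_norm_sq]
  calc ∑' i, ‖CFC.sqrt T (e i)‖ₑ ^ 2
      = ∑' i, ∑' k, ‖⟪e i, CFC.sqrt T (b k)⟫_ℂ‖ₑ ^ 2 := by
        refine tsum_congr fun i => ?_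
        rw [← tsum_enorm_inner_hilbertBasis_sq b]
        refine tsum_congr fun k => ?_
        rw [← inner_sqrt_left, enorm_inner_comm]
    _ = ∑' k, ∑' i, ‖⟪e i, CFC.sqrt T (b k)⟫_ℂ‖ₑ ^ 2 := ENNReal.tsum_comm
    _ ≤ ∑' k, ‖CFC.sqrt T (b k)‖ₑ ^ 2 := ENNReal.tsum_le_tsum fun k => he _

theorem posTrace_mono {S T : H →L[ℂ] H} (hS : 0 ≤ S) (hST : S ≤ T) : posTrace S ≤ posTrace T := by
  obtain ⟨w, b, -⟩ := exists_hilbertBasis ℂ H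
  rw [posTrace_eq b hS, posTrace_eq b (hS.trans hST)]
  exact ENNReal.tsum_le_tsum fun i => ENNReal.ofReal_le_ofReal (re_inner_mono hST (b i))

theorem posTrace_smul {c : ℝ} (hc : 0 ≤ c) (T : H →L[ℂ] H) :
    posTrace (c • T) = ENNReal.ofReal c * posTrace T := by
  rw [posTrace, posTrace, traceIn, traceIn, ← ENNReal.tsum_mul_left]
  refine tsum_congr fun i => ?_
  rw [← ENNReal.ofReal_mul hc]
  congr 1
  simp [inner_smul_right_eq_smul]

theorem rpow_le_norm_rpow_smul_rpow {T : H →L[ℂ] H} (hT : 0 ≤ T) {p q : ℝ} (hq : 0 < q)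
    (hqp : q ≤ p) : T ^ p ≤ ‖T‖ ^ (p - q) • T ^ q := by
  have hcont {r : ℝ} (hr : 0 < r) : ContinuousOn (fun t : ℝ => t ^ r) (spectrum ℝ T) :=
    (Real.continuous_rpow_const hr.le).continuousOn
  rw [CFC.rpow_eq_cfc_real hT, CFC.rpow_eq_cfc_real hT, ← cfc_const_mul _ _ T (hcont hq)]
  refine cfc_mono (fun t ht => ?_) (hcont (hq.trans_le hqp)) ((hcont hq).const_mul _)
  have h0 : 0 ≤ t := spectrum_nonneg_of_nonneg hT ht
  have hle : t ≤ ‖T‖ := (le_abs_self t).trans <|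
    (spectrum.norm_le_norm_mul_of_mem ht).trans <|
      mul_le_of_le_one_right (norm_nonneg T) ContinuousLinearMap.norm_id_le
  calc t ^ p = t ^ (p - q) * t ^ q := by
        rw [← Real.rpow_add_of_nonneg h0 (sub_nonneg.2 hqp) hq.le, sub_add_cancel]
    _ ≤ ‖T‖ ^ (p - q) * t ^ q := by gcongr

theorem MemSchatten.mono {X : H →L[ℂ] H} {p q : ℝ} (hX : MemSchatten q X) (hq : 0 < q)
    (hqp : q ≤ p) : MemSchatten p X :=
  calc posTrace (CFC.abs X ^ p) ≤ posTrace (‖CFC.abs X‖ ^ (p - q) • CFC.abs X ^ q) :=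
        posTrace_mono CFC.rpow_nonneg (rpow_le_norm_rpow_smul_rpow (CFC.abs_nonneg X) hq hqp)
    _ = ENNReal.ofReal (‖CFC.abs X‖ ^ (p - q)) * posTrace (CFC.abs X ^ q) :=
        posTrace_smul (by positivity) _
    _ < ∞ := ENNReal.mul_lt_top ENNReal.ofReal_lt_top hX

theorem rpow_tangent_le {s t p : ℝ} (hs : 0 < s) (ht : 0 ≤ t) (hp : 1 ≤ p) :
    p * s ^ (p - 1) * t - (p - 1) * s ^ p ≤ t ^ p := by
  have hst : -1 ≤ t / s - 1 := by linarith [div_nonneg ht hs.le]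
  have bernoulli := one_add_mul_self_le_rpow_one_add hst hp
  rw [add_sub_cancel, Real.div_rpow ht hs.le, le_div_iff₀ (by positivity)] at bernoulli
  calc p * s ^ (p - 1) * t - (p - 1) * s ^ p = (1 + p * (t / s - 1)) * s ^ p := by
        rw [Real.rpow_sub_one hs.ne']; field_simp; ring
    _ ≤ t ^ p := bernoulli

theorem smul_sub_smul_one_le_rpow {T : H →L[ℂ] H} (hT : 0 ≤ T) {s p : ℝ} (hs : 0 < s)
    (hp : 1 ≤ p) : (p * s ^ (p - 1)) • T - ((p - 1) * s ^ p) • (1 : H →L[ℂ] H) ≤ T ^ p := by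
  have hcfc : (p * s ^ (p - 1)) • T - ((p - 1) * s ^ p) • (1 : H →L[ℂ] H)
      = cfc (fun t : ℝ => p * s ^ (p - 1) * t - (p - 1) * s ^ p) T := by
    rw [cfc_sub .., cfc_const_mul_id .., cfc_const .., Algebra.algebraMap_eq_smul_one]
  rw [hcfc, CFC.rpow_eq_cfc_real hT]
  exact cfc_mono (fun t ht => rpow_tangent_le hs (spectrum_nonneg_of_nonneg hT ht) hp)
    (by fun_prop) (Real.continuous_rpow_const (by linarith)).continuousOn

-- Jensen's inequality for the functional `T ↦ ⟨x, T x⟩`, from the tangent line at `⟨x, T x⟩`.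
theorem re_inner_rpow_le {T : H →L[ℂ] H} (hT : 0 ≤ T) {p : ℝ} (hp : 1 ≤ p) {x : H}
    (hx : ‖x‖ ≤ 1) : (RCLike.re ⟪x, T x⟫_ℂ) ^ p ≤ RCLike.re ⟪x, (T ^ p) x⟫_ℂ := by
  set s := RCLike.re ⟪x, T x⟫_ℂ
  rcases (show 0 ≤ s from re_inner_nonneg hT x).eq_or_lt with hs | hs
  · rw [← hs, Real.zero_rpow (by linarith)]
    exact re_inner_nonneg CFC.rpow_nonneg x
  have hpow : s ^ p = s ^ (p - 1) * s := by rw [← Real.rpow_add_one hs.ne', sub_add_cancel]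
  calc s ^ p ≤ p * s ^ (p - 1) * s - (p - 1) * s ^ p * ‖x‖ ^ 2 := by
        have hcoef : 0 ≤ (p - 1) * s ^ p := mul_nonneg (by linarith) (by positivity)
        nlinarith [mul_le_of_le_one_right hcoef (pow_le_one₀ (n := 2) (norm_nonneg x) hx)]
    _ = RCLike.re ⟪x, ((p * s ^ (p - 1)) • T - ((p - 1) * s ^ p) • (1 : H →L[ℂ] H)) x⟫_ℂ := by
        rw [← inner_self_eq_norm_sq (𝕜 := ℂ) x]
        simp [inner_smul_right_eq_smul, s]
    _ ≤ RCLike.re ⟪x, (T ^ p) x⟫_ℂ := re_inner_mono (smul_sub_smul_one_le_rpow hT hs hp) x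

end PositiveTrace

section PolarDecomposition

theorem exists_comp_eq_of_norm_le {𝕜 E F G : Type*} [RCLike 𝕜] [NormedAddCommGroup E]
    [NormedSpace 𝕜 E] [NormedAddCommGroup F] [InnerProductSpace 𝕜 F] [CompleteSpace F]
    [NormedAddCommGroup G] [NormedSpace 𝕜 G] [CompleteSpace G] {X : E →L[𝕜] G} {T : E →L[𝕜] F}
    (hXT : ∀ x, ‖X x‖ ≤ ‖T x‖) : ∃ U : F →L[𝕜] G, ‖U‖ ≤ 1 ∧ U ∘L T = X := by
  let K := T.range.topologicalClosure
  have hmem (x : E) : T x ∈ K := subset_closure (LinearMap.mem_range_self T.toLinearMap x)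
  have : CompleteSpace K := T.range.isClosed_topologicalClosure.completeSpace_coe
  let S : E →ₗ[𝕜] K := T.toLinearMap.codRestrict K hmem
  have hdense : DenseRange S := fun z => by
    rw [Topology.IsInducing.subtypeVal.closure_eq_preimage_closure_image, Set.mem_preimage,
      ← Set.range_comp]
    exact z.2
  have hbound (x : E) : ‖X.toLinearMap x‖ ≤ 1 * ‖S x‖ := by simpa [S] using hXT x
  let V : K →L[𝕜] G := X.toLinearMap.extendOfNorm S
  refine ⟨V ∘L K.orthogonalProjectionOnto, ?_, ?_⟩
  · calc ‖V ∘L K.orthogonalProjectionOnto‖ ≤ ‖V‖ * ‖K.orthogonalProjectionOnto‖ :=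
          ContinuousLinearMap.opNorm_comp_le _ _
      _ ≤ 1 * 1 := by
          gcongr
          · exact LinearMap.opNorm_extendOfNorm_le hdense zero_le_one hbound
          · exact K.orthogonalProjectionOnto_norm_le
      _ = 1 := one_mul 1
  · ext x
    have hproj : K.orthogonalProjectionOnto (T x) = S x :=
      Submodule.orthogonalProjectionOnto_mem_subspace_eq_self (S x)
    rw [ContinuousLinearMap.comp_apply, ContinuousLinearMap.comp_apply, hproj]
    exact LinearMap.extendOfNorm_eq hdense ⟨1, hbound⟩ x

theorem star_apply_apply_eq_self {𝕜 H : Type*} [RCLike 𝕜] [NormedAddCommGroup H]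
    [InnerProductSpace 𝕜 H] [CompleteSpace H] {U : H →L[𝕜] H} (hU : ‖U‖ ≤ 1) {x : H}
    (hx : ‖U x‖ = ‖x‖) : star U (U x) = x := by
  have hle : ‖star U (U x)‖ ≤ ‖x‖ := by
    rw [← norm_star] at hU
    simpa [hx] using (star U).le_of_opNorm_le hU (U x)
  have hinner : RCLike.re ⟪star U (U x), x⟫_𝕜 = ‖x‖ ^ 2 := by
    rw [ContinuousLinearMap.star_eq_adjoint, ContinuousLinearMap.adjoint_inner_left,
      inner_self_eq_norm_sq, hx]
  have hsq : ‖star U (U x) - x‖ ^ 2 ≤ 0 := by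
    rw [norm_sub_sq (𝕜 := 𝕜), hinner]
    nlinarith [pow_le_pow_left₀ (norm_nonneg _) hle 2]
  simpa [sub_eq_zero] using le_antisymm hsq (sq_nonneg _)

variable {H : Type*} [NormedAddCommGroup H] [InnerProductSpace ℂ H] [CompleteSpace H]

theorem norm_abs_apply (X : H →L[ℂ] H) (x : H) : ‖CFC.abs X x‖ = ‖X x‖ := by
  have hsymm : (CFC.abs X).IsSymmetric :=
    ((ContinuousLinearMap.nonneg_iff_isPositive _).1 (CFC.abs_nonneg X)).isSymmetric
  have hinner : ⟪CFC.abs X x, CFC.abs X x⟫_ℂ = ⟪X x, X x⟫_ℂ :=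
    calc ⟪CFC.abs X x, CFC.abs X x⟫_ℂ = ⟪x, (CFC.abs X * CFC.abs X) x⟫_ℂ := hsymm _ _
      _ = ⟪X x, X x⟫_ℂ := by
        rw [CFC.abs_mul_abs, mul_apply_eq_comp, ContinuousLinearMap.star_eq_adjoint,
          ContinuousLinearMap.adjoint_inner_right]
  rw [norm_eq_sqrt_re_inner (𝕜 := ℂ), hinner, ← norm_eq_sqrt_re_inner]

theorem exists_polar_decomposition (X : H →L[ℂ] H) :
    ∃ U : H →L[ℂ] H, ‖U‖ ≤ 1 ∧ X = U * CFC.abs X ∧ CFC.abs X = star U * X := by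
  obtain ⟨U, hU, hUX⟩ := exists_comp_eq_of_norm_le fun x => (norm_abs_apply X x).ge
  refine ⟨U, hU, hUX.symm, ?_⟩
  ext x
  have hx : U (CFC.abs X x) = X x := DFunLike.congr_fun hUX x
  rw [mul_apply_eq_comp, ← hx, star_apply_apply_eq_self hU (by rw [hx, norm_abs_apply])]

end PolarDecomposition

section TraceNorm

variable {H : Type*} [NormedAddCommGroup H] [InnerProductSpace ℂ H] [CompleteSpace H]

theorem norm_inner_rpow_le {X U : H →L[ℂ] H} (hU : ‖U‖ ≤ 1) (hX : X = U * CFC.abs X) {p : ℝ}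
    (hp : 1 ≤ p) {x y : H} (hx : ‖x‖ ≤ 1) (hy : ‖y‖ ≤ 1) :
    ‖⟪y, X x⟫_ℂ‖ ^ p ≤ (RCLike.re ⟪star U y, (CFC.abs X ^ p) (star U y)⟫_ℂ +
      RCLike.re ⟪x, (CFC.abs X ^ p) x⟫_ℂ) / 2 := by
  have hT : 0 ≤ CFC.abs X := CFC.abs_nonneg X
  let R := CFC.sqrt (CFC.abs X)
  have hUy : ‖star U y‖ ≤ 1 := by
    rw [← norm_star] at hU
    simpa using (star U).le_of_opNorm_le_of_le hU hy
  have hinner : ⟪y, X x⟫_ℂ = ⟪R (star U y), R x⟫_ℂ := by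
    rw [inner_sqrt_sqrt hT, ContinuousLinearMap.star_eq_adjoint,
      ContinuousLinearMap.adjoint_inner_left, ← mul_apply_eq_comp, ← hX]
  have jensen {z : H} (hz : ‖z‖ ≤ 1) : (‖R z‖ ^ p) ^ 2 ≤ RCLike.re ⟪z, (CFC.abs X ^ p) z⟫_ℂ := by
    rw [Real.rpow_pow_comm (norm_nonneg _), norm_sqrt_apply_sq hT]
    exact re_inner_rpow_le hT hp hz
  calc ‖⟪y, X x⟫_ℂ‖ ^ p ≤ (‖R (star U y)‖ * ‖R x‖) ^ p := by
        rw [hinner]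
        gcongr
        exact norm_inner_le_norm _ _
    _ = ‖R (star U y)‖ ^ p * ‖R x‖ ^ p := Real.mul_rpow (norm_nonneg _) (norm_nonneg _)
    _ ≤ ((‖R (star U y)‖ ^ p) ^ 2 + (‖R x‖ ^ p) ^ 2) / 2 := by
        linarith [two_mul_le_add_sq (‖R (star U y)‖ ^ p) (‖R x‖ ^ p)]
    _ ≤ _ := by linarith [jensen hUy, jensen hx]

theorem IsBessel.tsum_enorm_inner_rpow_le {ι : Type*} {e f : ι → H} (he : IsBessel ℂ e)
    (hf : IsBessel ℂ f) (X : H →L[ℂ] H) {p : ℝ} (hp : 1 ≤ p) :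
    ∑' i, ‖⟪f i, X (e i)⟫_ℂ‖ₑ ^ p ≤ posTrace (CFC.abs X ^ p) := by
  obtain ⟨U, hU, hX, -⟩ := exists_polar_decomposition X
  have hTp : 0 ≤ CFC.abs X ^ p := CFC.rpow_nonneg
  have hUf : IsBessel ℂ fun i => star U (f i) := hf.map (by rwa [norm_star])
  calc ∑' i, ‖⟪f i, X (e i)⟫_ℂ‖ₑ ^ p
      ≤ ∑' i, (ENNReal.ofReal (RCLike.re ⟪star U (f i), (CFC.abs X ^ p) (star U (f i))⟫_ℂ) +
          ENNReal.ofReal (RCLike.re ⟪e i, (CFC.abs X ^ p) (e i)⟫_ℂ)) / 2 := by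
        refine ENNReal.tsum_le_tsum fun i => ?_
        rw [← ofReal_norm, ENNReal.ofReal_rpow_of_nonneg (norm_nonneg _) (by linarith),
          ← ENNReal.ofReal_add (re_inner_nonneg hTp _) (re_inner_nonneg hTp _),
          ← ENNReal.ofReal_ofNat 2, ← ENNReal.ofReal_div_of_pos two_pos]
        exact ENNReal.ofReal_le_ofReal
          (norm_inner_rpow_le hU hX hp (he.norm_le_one i) (hf.norm_le_one i))
    _ ≤ (posTrace (CFC.abs X ^ p) + posTrace (CFC.abs X ^ p)) / 2 := by
        simp only [div_eq_mul_inv]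
        rw [ENNReal.tsum_mul_right, ENNReal.tsum_add]
        gcongr
        · exact hUf.tsum_re_inner_le_posTrace hTp
        · exact he.tsum_re_inner_le_posTrace hTp
    _ = posTrace (CFC.abs X ^ p) := by rw [ENNReal.add_div, ENNReal.add_halves]

/-- The trace norm `tr |X|`, with values in `[0, ∞]` so that it makes sense for every bounded
operator; `schattenNorm 1` is its `toReal`. -/
noncomputable def eTraceNorm (X : H →L[ℂ] H) : ℝ≥0∞ :=
  posTrace (CFC.abs X)

theorem posTrace_abs_rpow_one (X : H →L[ℂ] H) : posTrace (CFC.abs X ^ (1 : ℝ)) = eTraceNorm X := by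
  rw [CFC.rpow_one _ (CFC.abs_nonneg X), eTraceNorm]

theorem memSchatten_one_iff {X : H →L[ℂ] H} : MemSchatten 1 X ↔ eTraceNorm X < ∞ := by
  rw [MemSchatten, posTrace_abs_rpow_one]

theorem IsBessel.tsum_enorm_inner_le_eTraceNorm {ι : Type*} {e f : ι → H} (he : IsBessel ℂ e)
    (hf : IsBessel ℂ f) (X : H →L[ℂ] H) : ∑' i, ‖⟪f i, X (e i)⟫_ℂ‖ₑ ≤ eTraceNorm X := by
  simpa [posTrace_abs_rpow_one] using he.tsum_enorm_inner_rpow_le hf X le_rfl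

theorem ofReal_re_le_enorm {𝕜 : Type*} [RCLike 𝕜] (z : 𝕜) :
    ENNReal.ofReal (RCLike.re z) ≤ ‖z‖ₑ := by
  rw [← ofReal_norm]
  exact ENNReal.ofReal_le_ofReal (RCLike.re_le_norm z)

theorem exists_isBessel_eTraceNorm_le_tsum (X : H →L[ℂ] H) :
    ∃ (ι : Set H) (e f : ι → H), IsBessel ℂ e ∧ IsBessel ℂ f ∧
      eTraceNorm X ≤ ∑' i, ‖⟪f i, X (e i)⟫_ℂ‖ₑ := by
  obtain ⟨U, hU, -, hX⟩ := exists_polar_decomposition X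
  obtain ⟨w, b, -⟩ := exists_hilbertBasis ℂ H
  have hb := isBessel_of_orthonormal b.orthonormal
  refine ⟨w, b, fun i => U (b i), hb, hb.map hU, ?_⟩
  rw [eTraceNorm, posTrace_eq b (CFC.abs_nonneg X), traceIn]
  refine ENNReal.tsum_le_tsum fun i => (ofReal_re_le_enorm _).trans_eq ?_
  rw [hX, mul_apply_eq_comp, ContinuousLinearMap.star_eq_adjoint,
    ContinuousLinearMap.adjoint_inner_right]

theorem eTraceNorm_le_tsum_of_hasSum {ι : Type*} {X : ι → H →L[ℂ] H} {Y : H →L[ℂ] H}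
    (hY : HasSum X Y) : eTraceNorm Y ≤ ∑' n, eTraceNorm (X n) := by
  obtain ⟨w, e, f, he, hf, hYef⟩ := exists_isBessel_eTraceNorm_le_tsum Y
  have hinner (i : w) : HasSum (fun n => ⟪f i, X n (e i)⟫_ℂ) ⟪f i, Y (e i)⟫_ℂ :=
    (hY.mapL (ContinuousLinearMap.apply ℂ H (e i))).mapL (innerSL ℂ (f i))
  calc eTraceNorm Y ≤ ∑' i, ‖⟪f i, Y (e i)⟫_ℂ‖ₑ := hYef
    _ ≤ ∑' i, ∑' n, ‖⟪f i, X n (e i)⟫_ℂ‖ₑ :=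
      ENNReal.tsum_le_tsum fun i => (hinner i).tsum_eq ▸ enorm_tsum_le_tsum_enorm
    _ = ∑' n, ∑' i, ‖⟪f i, X n (e i)⟫_ℂ‖ₑ := ENNReal.tsum_comm
    _ ≤ ∑' n, eTraceNorm (X n) :=
      ENNReal.tsum_le_tsum fun n => he.tsum_enorm_inner_le_eTraceNorm hf (X n)

theorem eTraceNorm_add_le (X Y : H →L[ℂ] H) :
    eTraceNorm (X + Y) ≤ eTraceNorm X + eTraceNorm Y := by
  simpa using eTraceNorm_le_tsum_of_hasSum (hasSum_fintype ![X, Y])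

theorem eTraceNorm_sub_le (X Y : H →L[ℂ] H) :
    eTraceNorm (X - Y) ≤ eTraceNorm X + eTraceNorm Y := by
  simpa [sub_eq_add_neg, eTraceNorm, CFC.abs_neg] using eTraceNorm_add_le X (-Y)

theorem MemSchatten.sub {X Y : H →L[ℂ] H} (hX : MemSchatten 1 X) (hY : MemSchatten 1 Y) :
    MemSchatten 1 (X - Y) := by
  rw [memSchatten_one_iff] at hX hY ⊢
  exact (eTraceNorm_sub_le X Y).trans_lt (ENNReal.add_lt_top.2 ⟨hX, hY⟩)

theorem eTraceNorm_rankOne_le (x y : H) :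
    eTraceNorm (InnerProductSpace.rankOne ℂ x y) ≤ ‖x‖ₑ * ‖y‖ₑ := by
  obtain ⟨w, e, f, he, hf, hef⟩ :=
    exists_isBessel_eTraceNorm_le_tsum (InnerProductSpace.rankOne ℂ x y)
  calc eTraceNorm (InnerProductSpace.rankOne ℂ x y)
      ≤ ∑' i, ‖⟪f i, x⟫_ℂ‖ₑ * ‖⟪e i, y⟫_ℂ‖ₑ := by
        refine hef.trans_eq (tsum_congr fun i => ?_)
        rw [InnerProductSpace.rankOne_apply, inner_smul_right, enorm_mul, enorm_inner_comm y,
          mul_comm]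
    _ ≤ (∑' i, ‖⟪f i, x⟫_ℂ‖ₑ ^ 2) ^ (1 / 2 : ℝ) * (∑' i, ‖⟪e i, y⟫_ℂ‖ₑ ^ 2) ^ (1 / 2 : ℝ) :=
        tsum_mul_le_rpow_mul_rpow _ _
    _ ≤ (‖x‖ₑ ^ 2) ^ (1 / 2 : ℝ) * (‖y‖ₑ ^ 2) ^ (1 / 2 : ℝ) := by
        gcongr
        exacts [hf x, he y]
    _ = ‖x‖ₑ * ‖y‖ₑ := by rw [sq_rpow_half, sq_rpow_half]

theorem eTraceNorm_pinching_le {P : H →L[ℂ] H} (hP : IsStarProjection P) (X : H →L[ℂ] H) :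
    eTraceNorm (P * X * P) + eTraceNorm ((1 - P) * X * (1 - P)) ≤ eTraceNorm X := by
  obtain ⟨v, e, f, he, hf, hef⟩ := exists_isBessel_eTraceNorm_le_tsum (P * X * P)
  obtain ⟨w, e', f', he', hf', hef'⟩ :=
    exists_isBessel_eTraceNorm_le_tsum ((1 - P) * X * (1 - P))
  refine (add_le_add hef hef').trans (le_trans (le_of_eq ?_)
    ((he.sumElim hP he').tsum_enorm_inner_le_eTraceNorm (hf.sumElim hP hf') X))
  rw [ENNReal.summable.tsum_sum ENNReal.summable]
  simp only [Sum.elim_inl, Sum.elim_inr, inner_starProjection_left hP,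
    inner_starProjection_left hP.one_sub, mul_apply_eq_comp]

end TraceNorm

section FiniteRank

variable {H : Type*} [NormedAddCommGroup H] [InnerProductSpace ℂ H] [CompleteSpace H]

-- Cyclicity of the trace, `tr (V Y) = tr (Y V)`, for `Y` of finite rank.
theorem hasSum_inner_hilbertBasis_mul {ι κ : Type*} [Fintype κ] (b : HilbertBasis ι ℂ H)
    (V : H →L[ℂ] H) {Y : H →L[ℂ] H} {u : κ → H} (hu : ∀ x, ∑ j, ⟪u j, Y x⟫_ℂ • u j = Y x) :
    HasSum (fun k => ⟪b k, (V * Y) (b k)⟫_ℂ) (∑ j, ⟪u j, Y (V (u j))⟫_ℂ) := by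
  convert! hasSum_sum fun j (_ : j ∈ Finset.univ) =>
    b.hasSum_inner_mul_inner (star Y (u j)) (V (u j)) using 1
  · ext k
    rw [mul_apply_eq_comp, ← hu (b k)]
    simp only [map_sum, map_smul, inner_sum, inner_smul_right,
      ContinuousLinearMap.star_eq_adjoint, ContinuousLinearMap.adjoint_inner_left]
  · simp only [ContinuousLinearMap.star_eq_adjoint, ContinuousLinearMap.adjoint_inner_left]

theorem exists_isBessel_eTraceNorm_le_sum (Y : H →L[ℂ] H) [FiniteDimensional ℂ Y.range] :
    ∃ e f : Fin (Module.finrank ℂ Y.range) → H, IsBessel ℂ e ∧ IsBessel ℂ f ∧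
      eTraceNorm Y ≤ ∑ j, ‖⟪f j, Y (e j)⟫_ℂ‖ₑ := by
  obtain ⟨U, hU, -, hY⟩ := exists_polar_decomposition Y
  obtain ⟨w, b, -⟩ := exists_hilbertBasis ℂ H
  let v := stdOrthonormalBasis ℂ Y.range
  let u (j) : H := v j
  have hu : Orthonormal ℂ u := v.orthonormal.comp_linearIsometry Y.range.subtypeₗᵢ
  have hYu (x : H) : ∑ j, ⟪u j, Y x⟫_ℂ • u j = Y x := by
    simpa using congrArg Subtype.val (v.sum_repr' ⟨Y x, LinearMap.mem_range_self Y.toLinearMap x⟩)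
  refine ⟨fun j => star U (u j), u, (isBessel_of_orthonormal hu).map (by rwa [norm_star]),
    isBessel_of_orthonormal hu, ?_⟩
  have htrace := RCLike.hasSum_re ℂ (hasSum_inner_hilbertBasis_mul b (star U) hYu)
  rw [← hY] at htrace
  rw [eTraceNorm, posTrace_eq b (CFC.abs_nonneg Y), traceIn, ← ENNReal.ofReal_tsum_of_nonneg
    (fun k => re_inner_nonneg (CFC.abs_nonneg Y) (b k)) htrace.summable, htrace.tsum_eq]
  exact (ofReal_re_le_enorm _).trans (enorm_sum_le _ _)

theorem sum_le_card_rpow_mul_sum_rpow {ι : Type*} (s : Finset ι) (a : ι → ℝ≥0∞) {p : ℝ}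
    (hp : 1 ≤ p) :
    ∑ j ∈ s, a j ≤ (s.card : ℝ≥0∞) ^ ((p - 1) / p) * (∑ j ∈ s, a j ^ p) ^ (1 / p) := by
  have hp0 : 0 < p := by linarith
  have h := ENNReal.rpow_le_rpow (ENNReal.rpow_sum_le_const_mul_sum_rpow s a hp)
    (one_div_nonneg.2 hp0.le)
  rwa [ENNReal.mul_rpow_of_nonneg _ _ (by positivity), ← ENNReal.rpow_mul, ← ENNReal.rpow_mul,
    mul_one_div_cancel hp0.ne', ENNReal.rpow_one, mul_one_div] at h

theorem eTraceNorm_mul_mul_le_of_rank_le {B C : H →L[ℂ] H} (hB : ‖B‖ ≤ 1) (hC : ‖C‖ ≤ 1)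
    (X : H →L[ℂ] H) {n : ℕ} (hn : (B * X * C).toLinearMap.rank ≤ n) {p : ℝ} (hp : 1 ≤ p) :
    eTraceNorm (B * X * C) ≤
      (n : ℝ≥0∞) ^ ((p - 1) / p) * posTrace (CFC.abs X ^ p) ^ (1 / p) := by
  have : FiniteDimensional ℂ (B * X * C).range :=
    Module.rank_lt_aleph0_iff.1 (hn.trans_lt Cardinal.natCast_lt_aleph0)
  obtain ⟨e, f, he, hf, hef⟩ := exists_isBessel_eTraceNorm_le_sum (B * X * C)
  have hBf : IsBessel ℂ fun j => star B (f j) := hf.map (by rwa [norm_star])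
  calc eTraceNorm (B * X * C) ≤ ∑ j, ‖⟪star B (f j), X (C (e j))⟫_ℂ‖ₑ := by
        simpa only [mul_apply_eq_comp, ContinuousLinearMap.star_eq_adjoint,
          ContinuousLinearMap.adjoint_inner_left] using hef
    _ ≤ _ := sum_le_card_rpow_mul_sum_rpow _ _ hp
    _ ≤ (n : ℝ≥0∞) ^ ((p - 1) / p) * posTrace (CFC.abs X ^ p) ^ (1 / p) := by
        have : 0 ≤ (p - 1) / p := div_nonneg (by linarith) (by linarith)
        rw [← tsum_fintype (L := .unconditional _)]
        gcongr
        · rw [Finset.card_univ, Fintype.card_fin]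
          exact Module.finrank_le_of_rank_le hn
        · exact (he.map hC).tsum_enorm_inner_rpow_le hBf X hp

end FiniteRank

section ApproximationByCompression

variable {H : Type*} [NormedAddCommGroup H] [InnerProductSpace ℂ H] [CompleteSpace H]

theorem eTraceNorm_compl_compression_le {P A₀ A : H →L[ℂ] H} (hP : IsStarProjection P)
    (hPA₀ : Commute P A₀) (hA : eTraceNorm A < ∞) (hle : eTraceNorm A ≤ eTraceNorm A₀) :
    eTraceNorm ((1 - P) * A * (1 - P)) ≤
      eTraceNorm (P * (A₀ - A) * P) + eTraceNorm ((1 - P) * A₀) := by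
  have hpinch := eTraceNorm_pinching_le hP A
  have hfin : eTraceNorm (P * A * P) ≠ ∞ := ((le_self_add.trans hpinch).trans_lt hA).ne
  have hsplit : A₀ = P * A * P + (P * (A₀ - A) * P + (1 - P) * A₀) := by
    have hPA₀P : P * A₀ * P = P * A₀ := by
      rw [mul_assoc, ← hPA₀.eq, ← mul_assoc, hP.isIdempotentElem.eq]
    rw [mul_sub, sub_mul, hPA₀P]
    noncomm_ring
  refine (ENNReal.add_le_add_iff_left hfin).1 ?_
  calc eTraceNorm (P * A * P) + eTraceNorm ((1 - P) * A * (1 - P)) ≤ eTraceNorm A₀ :=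
        hpinch.trans hle
    _ ≤ eTraceNorm (P * A * P) +
          (eTraceNorm (P * (A₀ - A) * P) + eTraceNorm ((1 - P) * A₀)) := by
        conv_lhs => rw [hsplit]
        exact (eTraceNorm_add_le _ _).trans (by gcongr; exact eTraceNorm_add_le _ _)

theorem eTraceNorm_sub_le_of_commute {P A₀ A : H →L[ℂ] H} (hP : IsStarProjection P)
    {n : ℕ} (hn : P.toLinearMap.rank ≤ n) (hPA₀ : Commute P A₀) (hA : eTraceNorm A < ∞)
    (hle : eTraceNorm A ≤ eTraceNorm A₀) {p : ℝ} (hp : 1 ≤ p) :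
    eTraceNorm (A₀ - A) ≤
      3 * ((n : ℝ≥0∞) ^ ((p - 1) / p) * posTrace (CFC.abs (A₀ - A) ^ p) ^ (1 / p)) +
        2 * eTraceNorm ((1 - P) * A₀) := by
  set D := A₀ - A with hD
  set K := (n : ℝ≥0∞) ^ ((p - 1) / p) * posTrace (CFC.abs D ^ p) ^ (1 / p)
  have hleft {C : H →L[ℂ] H} (hC : ‖C‖ ≤ 1) : eTraceNorm (P * D * C) ≤ K :=
    eTraceNorm_mul_mul_le_of_rank_le hP.norm_le hC D
      ((LinearMap.rank_comp_le_left (D * C).toLinearMap P.toLinearMap).trans hn) hp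
  have hright {B : H →L[ℂ] H} (hB : ‖B‖ ≤ 1) : eTraceNorm (B * D * P) ≤ K :=
    eTraceNorm_mul_mul_le_of_rank_le hB hP.norm_le D
      ((LinearMap.rank_comp_le_right P.toLinearMap (B * D).toLinearMap).trans hn) hp
  have hsplit : D = P * D * 1 + (1 - P) * D * P +
      ((1 - P) * A₀ - (1 - P) * A * (1 - P)) := by
    have hQA₀P : (1 - P) * A₀ * P = 0 := by
      rw [mul_assoc, ← hPA₀.eq, ← mul_assoc, hP.isIdempotentElem.one_sub_mul_self, zero_mul]
    have hQDP : (1 - P) * D * P = - ((1 - P) * A * P) := by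
      rw [hD, mul_sub, sub_mul, hQA₀P, zero_sub]
    rw [hQDP, hD]
    noncomm_ring
  calc eTraceNorm D ≤ eTraceNorm (P * D * 1) + eTraceNorm ((1 - P) * D * P) +
          (eTraceNorm ((1 - P) * A₀) + eTraceNorm ((1 - P) * A * (1 - P))) := by
        conv_lhs => rw [hsplit]
        exact (eTraceNorm_add_le _ _).trans
          (add_le_add (eTraceNorm_add_le _ _) (eTraceNorm_sub_le _ _))
    _ ≤ K + K + (eTraceNorm ((1 - P) * A₀) + (K + eTraceNorm ((1 - P) * A₀))) := by
        gcongr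
        · exact hleft ContinuousLinearMap.norm_id_le
        · exact hright hP.one_sub.norm_le
        · exact (eTraceNorm_compl_compression_le hP hPA₀ hA hle).trans
            (by gcongr; exact hleft hP.norm_le)
    _ = 3 * K + 2 * eTraceNorm ((1 - P) * A₀) := by ring

end ApproximationByCompression

section SpectralProjection

variable {ι H : Type*} [NormedAddCommGroup H] [InnerProductSpace ℂ H]

theorem starProjection_span_image_apply {u : ι → H} (hu : Orthonormal ℂ u) (s : Set ι)
    [DecidablePred (· ∈ s)] [(Submodule.span ℂ (u '' s)).HasOrthogonalProjection] (n : ι) :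
    (Submodule.span ℂ (u '' s)).starProjection (u n) = if n ∈ s then u n else 0 := by
  split_ifs with hn
  · exact Submodule.starProjection_eq_self_iff.2 (Submodule.subset_span ⟨n, hn, rfl⟩)
  · rw [Submodule.starProjection_apply_eq_zero_iff, Submodule.mem_orthogonal]
    intro x hx
    induction hx using Submodule.span_induction with
    | mem x hx =>
      obtain ⟨m, hm, rfl⟩ := hx
      exact hu.2 fun hmn => hn (hmn ▸ hm)
    | zero => exact inner_zero_left _
    | add x y _ _ hx hy => rw [inner_add_left, hx, hy, add_zero]
    | smul c x _ hx => rw [inner_smul_left, hx, mul_zero]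

variable [CompleteSpace H]

theorem commute_of_hasSum_rankOne {P A : H →L[ℂ] H} (hP : IsStarProjection P) {μ : ι → ℂ}
    {u : ι → H} (h : HasSum (fun n => μ n • InnerProductSpace.rankOne ℂ (u n) (u n)) A)
    (hPu : ∀ n, P (u n) = u n ∨ P (u n) = 0) : Commute P A := by
  refine (h.mul_left P).unique ?_
  convert! h.mul_right P using 2 with n
  rw [mul_smul_comm, smul_mul_assoc, ContinuousLinearMap.mul_def, ContinuousLinearMap.mul_def,
    InnerProductSpace.comp_rankOne, InnerProductSpace.rankOne_comp,
    ← ContinuousLinearMap.star_eq_adjoint, hP.isSelfAdjoint.star_eq]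
  rcases hPu n with hn | hn <;> simp [hn]

theorem eTraceNorm_mul_le_tsum_subtype {Q A : H →L[ℂ] H} (hQ : ‖Q‖ ≤ 1) {μ : ι → ℂ}
    {u : ι → H} (hu : ∀ n, ‖u n‖ ≤ 1)
    (h : HasSum (fun n => μ n • InnerProductSpace.rankOne ℂ (u n) (u n)) A)
    {s : Set ι} (hQu : ∀ n ∉ s, Q (u n) = 0) : eTraceNorm (Q * A) ≤ ∑' n : s, ‖μ n‖ₑ := by
  have hrankOne (n : ι) : Q * (μ n • InnerProductSpace.rankOne ℂ (u n) (u n)) =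
      InnerProductSpace.rankOne ℂ (μ n • Q (u n)) (u n) := by
    rw [mul_smul_comm, ContinuousLinearMap.mul_def, InnerProductSpace.comp_rankOne, map_smul,
      smul_apply]
  have hterm (n : ι) : eTraceNorm (InnerProductSpace.rankOne ℂ (μ n • Q (u n)) (u n)) ≤
      s.indicator (fun n => ‖μ n‖ₑ) n := by
    refine (eTraceNorm_rankOne_le _ _).trans ?_
    by_cases hn : n ∈ s
    · have hun : ‖u n‖ₑ ≤ 1 := by
        rw [← ofReal_norm]
        exact ENNReal.ofReal_le_one.2 (hu n)
      have hQun : ‖Q (u n)‖ₑ ≤ 1 := by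
        rw [← ofReal_norm]
        exact ENNReal.ofReal_le_one.2 (by simpa using Q.le_of_opNorm_le_of_le hQ (hu n))
      rw [Set.indicator_of_mem hn, enorm_smul, mul_assoc]
      exact mul_le_of_le_one_right' (mul_le_one' hQun hun)
    · simp [hQu n hn]
  calc eTraceNorm (Q * A) ≤ ∑' n, eTraceNorm (InnerProductSpace.rankOne ℂ (μ n • Q (u n)) (u n)) :=
        eTraceNorm_le_tsum_of_hasSum (by simpa only [hrankOne] using h.mul_left Q)
    _ ≤ ∑' n, s.indicator (fun n => ‖μ n‖ₑ) n := ENNReal.tsum_le_tsum hterm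
    _ = ∑' n : s, ‖μ n‖ₑ := (tsum_subtype s _).symm

theorem eTraceNorm_sub_le_of_hasSum {A₀ A : H →L[ℂ] H} {μ : ι → ℂ} {u : ι → H}
    (hu : Orthonormal ℂ u)
    (h : HasSum (fun n => μ n • InnerProductSpace.rankOne ℂ (u n) (u n)) A₀)
    (hA : eTraceNorm A < ∞) (hle : eTraceNorm A ≤ eTraceNorm A₀) {p : ℝ} (hp : 1 ≤ p)
    {s : Set ι} {n : ℕ} (hs : s.encard ≤ n) :
    eTraceNorm (A₀ - A) ≤
      3 * ((n : ℝ≥0∞) ^ ((p - 1) / p) * posTrace (CFC.abs (A₀ - A) ^ p) ^ (1 / p)) +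
        2 * ∑' n : ↥sᶜ, ‖μ n‖ₑ := by
  classical
  have hfin : s.Finite := Set.finite_of_encard_le_coe hs
  let K := Submodule.span ℂ (u '' s)
  have : FiniteDimensional ℂ K := FiniteDimensional.span_of_finite ℂ (hfin.image u)
  have hrank : K.starProjection.toLinearMap.rank ≤ n := by
    rw [LinearMap.rank, Submodule.range_starProjection]
    refine (rank_span_le _).trans (Cardinal.toENat_le_natCast.1 ?_)
    rw [Set.toENat_cardinalMk]
    exact (Set.encard_image_le u s).trans hs
  have hPu (n : ι) : K.starProjection (u n) = if n ∈ s then u n else 0 :=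
    starProjection_span_image_apply hu s n
  have hcomm : Commute K.starProjection A₀ :=
    commute_of_hasSum_rankOne isStarProjection_starProjection h fun n => by
      rw [hPu]
      exact ite_eq_or_eq _ _ _
  have htail : eTraceNorm ((1 - K.starProjection) * A₀) ≤ ∑' n : ↥sᶜ, ‖μ n‖ₑ :=
    eTraceNorm_mul_le_tsum_subtype isStarProjection_starProjection.one_sub.norm_le
      (fun n => (hu.1 n).le) h fun n hn => by simp [hPu, Set.notMem_compl_iff.1 hn]
  exact (eTraceNorm_sub_le_of_commute isStarProjection_starProjection hrank hcomm hA hle hp).trans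
    (by gcongr)

end SpectralProjection

section Compactness

theorem isCompactOperator_rankOne {𝕜 E F : Type*} [RCLike 𝕜] [NormedAddCommGroup E]
    [NormedSpace 𝕜 E] [NormedAddCommGroup F] [InnerProductSpace 𝕜 F] (x : E) (y : F) :
    IsCompactOperator (InnerProductSpace.rankOne 𝕜 x y) := by
  rw [InnerProductSpace.rankOne_def']
  exact (isCompactOperator_of_locallyCompactSpace_dom (innerSL 𝕜 y)).clm_comp
    (ContinuousLinearMap.toSpanSingleton 𝕜 x)

theorem isCompactOperator_of_tsum_enorm_sq_lt_top {𝕜 E F ι : Type*} [RCLike 𝕜]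
    [NormedAddCommGroup E] [NormedSpace 𝕜 E] [CompleteSpace E] [NormedAddCommGroup F]
    [InnerProductSpace 𝕜 F] (b : HilbertBasis ι 𝕜 F) {X : F →L[𝕜] E}
    (hX : ∑' k, ‖X (b k)‖ₑ ^ 2 < ∞) : IsCompactOperator X := by
  classical
  let S (s : Finset ι) : F →L[𝕜] E := ∑ k ∈ s, InnerProductSpace.rankOne 𝕜 (X (b k)) (b k)
  have hS (s : Finset ι) : IsCompactOperator (S s) :=
    (compactOperator (RingHom.id 𝕜) F E).sum_mem fun k _ => isCompactOperator_rankOne _ _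
  have hXS (s : Finset ι) (k : ι) : (X - S s) (b k) = if k ∈ s then 0 else X (b k) := by
    have hSb : S s (b k) = if k ∈ s then X (b k) else 0 := by
      simp [S, orthonormal_iff_ite.1 b.orthonormal]
    rw [sub_apply, hSb]
    split_ifs <;> simp
  have hbound (s : Finset ι) :
      ‖X - S s‖ₑ ≤ (∑' k : {k // k ∉ s}, ‖X (b k)‖ₑ ^ 2) ^ (1 / 2 : ℝ) := by
    refine (enorm_opNorm_le_tsum_hilbertBasis b _).trans_eq ?_
    congr 1
    rw [← tsum_subtype_eq_of_support_subset (s := {k | k ∉ s})]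
    · exact tsum_congr fun k => by rw [hXS, if_neg k.2]
    · intro k hk hks
      exact hk (by simp [hXS, hks])
  have hlim : Filter.Tendsto S Filter.atTop (nhds X) := by
    have htail : Filter.Tendsto
        (fun s : Finset ι => (∑' k : {k // k ∉ s}, ‖X (b k)‖ₑ ^ 2) ^ (1 / 2 : ℝ))
        Filter.atTop (nhds 0) := by
      simpa using (ENNReal.tendsto_tsum_compl_atTop_zero hX.ne).ennrpow_const (1 / 2 : ℝ)
    rw [tendsto_iff_edist_tendsto_0]
    refine tendsto_of_tendsto_of_tendsto_of_le_of_le tendsto_const_nhds htail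
      (fun _ => zero_le) fun s => ?_
    rw [edist_comm, edist_eq_enorm_sub]
    exact hbound s
  exact isCompactOperator_of_tendsto hlim (.of_forall hS)

variable {H : Type*} [NormedAddCommGroup H] [InnerProductSpace ℂ H] [CompleteSpace H]

theorem posTrace_abs_rpow_two {ι : Type*} (b : HilbertBasis ι ℂ H) (X : H →L[ℂ] H) :
    posTrace (CFC.abs X ^ (2 : ℝ)) = ∑' k, ‖X (b k)‖ₑ ^ 2 := by
  have habs : CFC.abs X ^ (2 : ℝ) = star X * X := by
    rw [← CFC.abs_sq, ← CFC.rpow_natCast _ 2 (CFC.abs_nonneg X), Nat.cast_ofNat]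
  rw [posTrace_eq b CFC.rpow_nonneg, traceIn]
  refine tsum_congr fun k => ?_
  rw [habs, enorm_sq_eq_ofReal_norm_sq, mul_apply_eq_comp, ContinuousLinearMap.star_eq_adjoint,
    ContinuousLinearMap.adjoint_inner_right, inner_self_eq_norm_sq (𝕜 := ℂ)]

theorem MemSchatten.isCompactOperator {X : H →L[ℂ] H} (hX : MemSchatten 1 X) :
    IsCompactOperator X := by
  obtain ⟨w, b, -⟩ := exists_hilbertBasis ℂ H
  have hX₂ : MemSchatten 2 X := hX.mono one_pos one_le_two
  rw [MemSchatten, posTrace_abs_rpow_two b] at hX₂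
  exact isCompactOperator_of_tsum_enorm_sq_lt_top b hX₂

end Compactness

section CompactNormal

open Module.End

variable {H : Type*} [NormedAddCommGroup H] [InnerProductSpace ℂ H] [CompleteSpace H]
  {A : H →L[ℂ] H}

theorem star_apply_of_apply_eq_smul {𝕜 E : Type*} [RCLike 𝕜] [NormedAddCommGroup E]
    [InnerProductSpace 𝕜 E] [CompleteSpace E] {A : E →L[𝕜] E} (hA : IsStarNormal A) {c : 𝕜}
    {v : E} (hv : A v = c • v) : star A v = starRingEnd 𝕜 c • v := by
  have hnormal : IsStarNormal (A - c • (1 : E →L[𝕜] E)) := by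
    refine Commute.isStarNormal_sub ?_
    rw [star_smul, star_one]
    exact (Commute.one_right A).smul_right _
  have hker :=
    (ContinuousLinearMap.IsStarNormal.adjoint_apply_eq_zero_iff hnormal v).2 (by simp [hv])
  rw [← ContinuousLinearMap.star_eq_adjoint] at hker
  simpa [sub_eq_zero] using hker

theorem isOrtho_eigenspace (hA : IsStarNormal A) {c d : ℂ} (hcd : c ≠ d) :
    eigenspace A.toLinearMap c ⟂ eigenspace A.toLinearMap d := by
  refine Submodule.isOrtho_iff_inner_eq.2 fun v hv w hw => ?_
  have hv' : star A v = starRingEnd ℂ c • v :=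
    star_apply_of_apply_eq_smul hA (mem_eigenspace_iff.1 hv)
  have hw' : A w = d • w := mem_eigenspace_iff.1 hw
  have hinner : c * ⟪v, w⟫_ℂ = d * ⟪v, w⟫_ℂ := by
    rw [← inner_smul_right v w d, ← hw', ← ContinuousLinearMap.adjoint_inner_left,
      ← ContinuousLinearMap.star_eq_adjoint, hv', inner_smul_left, RCLike.conj_conj]
  exact (mul_eq_mul_right_iff.1 hinner).resolve_left hcd

theorem apply_mem_orthogonal_of_star_mapsTo {𝕜 E : Type*} [RCLike 𝕜] [NormedAddCommGroup E]
    [InnerProductSpace 𝕜 E] [CompleteSpace E] {A : E →L[𝕜] E} {V : Submodule 𝕜 E}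
    (hV : ∀ v ∈ V, star A v ∈ V) {x : E} (hx : x ∈ Vᗮ) : A x ∈ Vᗮ := by
  intro v hv
  rw [← ContinuousLinearMap.adjoint_inner_left, ← ContinuousLinearMap.star_eq_adjoint]
  exact hx _ (hV v hv)

theorem isStarNormal_restrict {𝕜 E : Type*} [RCLike 𝕜] [NormedAddCommGroup E]
    [InnerProductSpace 𝕜 E] [CompleteSpace E] {A : E →L[𝕜] E} (hA : IsStarNormal A)
    {V : Submodule 𝕜 E} [CompleteSpace V] (hV : ∀ x ∈ V, A x ∈ V) (hV' : ∀ x ∈ V, star A x ∈ V) :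
    IsStarNormal (A.restrict hV) := by
  have hstar : star (A.restrict hV) = (star A).restrict hV' := by
    rw [ContinuousLinearMap.star_eq_adjoint, eq_comm, ContinuousLinearMap.eq_adjoint_iff]
    intro x y
    exact ContinuousLinearMap.adjoint_inner_left A (y : E) (x : E)
  rw [isStarNormal_iff, hstar]
  ext x
  exact congrArg (fun B : E →L[𝕜] E => B x) hA.star_comm_self.eq

theorem exists_hasEigenvalue_of_isCompactOperator [Nontrivial H] (hA : IsStarNormal A)
    (hc : IsCompactOperator A) : ∃ c, HasEigenvalue A.toLinearMap c := by
  let S : H →L[ℂ] H := star A * A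
  have hS : IsCompactOperator S := hc.clm_comp (star A)
  by_cases h : ∀ s, HasEigenvalue S.toLinearMap s → s = 0
  · have hS₀ : star A * A = 0 :=
      (ContinuousLinearMap.eq_zero_of_forall_hasEigenvalue_eq_zero hS
        (IsSelfAdjoint.star_mul_self A).isSymmetric).1 h
    obtain ⟨x, hx⟩ := exists_ne (0 : H)
    refine ⟨0, hasEigenvalue_of_hasEigenvector (x := x) ⟨mem_eigenspace_iff.2 ?_, hx⟩⟩
    simp [CStarRing.star_mul_self_eq_zero_iff A |>.1 hS₀]
  · push Not at h
    obtain ⟨s, hs, hs₀⟩ := h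
    have := ContinuousLinearMap.finite_dimensional_eigenspace hS s hs₀
    have : Nontrivial (eigenspace S.toLinearMap s) := Submodule.nontrivial_iff_ne_bot.2 hs
    have hcomm : Commute S A := (hA.star_comm_self).mul_left (Commute.refl A)
    have hinv : ∀ x ∈ eigenspace S.toLinearMap s, A.toLinearMap x ∈ eigenspace S.toLinearMap s := by
      intro x hx
      rw [mem_eigenspace_iff] at hx ⊢
      calc S (A x) = A (S x) := congrArg (fun B : H →L[ℂ] H => B x) hcomm.eq
        _ = s • A x := by rw [show S x = s • x from hx, map_smul]
    obtain ⟨c, hcE⟩ := exists_eigenvalue (A.toLinearMap.restrict hinv)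
    obtain ⟨x, hx⟩ := hcE.exists_hasEigenvector
    refine ⟨c, hasEigenvalue_of_hasEigenvector (x := (x : H)) ⟨mem_eigenspace_iff.2 ?_, ?_⟩⟩
    · exact congrArg Subtype.val hx.apply_eq_smul
    · exact Subtype.coe_ne_coe.2 hx.2

theorem orthogonal_iSup_eigenspace_eq_bot (hA : IsStarNormal A) (hc : IsCompactOperator A) :
    (⨆ c, eigenspace A.toLinearMap c)ᗮ = ⊥ := by
  set V := ⨆ c, eigenspace A.toLinearMap c with hV
  have hVA : ∀ x ∈ Vᗮ, A x ∈ Vᗮ := by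
    rw [hV, ← Submodule.iInf_orthogonal]
    refine A.toLinearMap.iInf_invariant fun c x =>
      apply_mem_orthogonal_of_star_mapsTo fun v hv => ?_
    rw [star_apply_of_apply_eq_smul hA (mem_eigenspace_iff.1 hv)]
    exact Submodule.smul_mem _ _ hv
  have hVA' : ∀ x ∈ Vᗮ, star A x ∈ Vᗮ := by
    rw [hV, ← Submodule.iInf_orthogonal]
    refine (star A).toLinearMap.iInf_invariant fun c x =>
      apply_mem_orthogonal_of_star_mapsTo fun v hv => ?_
    rw [star_star, show A v = c • v from mem_eigenspace_iff.1 hv]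
    exact Submodule.smul_mem _ c hv
  by_contra hbot
  have : Nontrivial Vᗮ := Submodule.nontrivial_iff_ne_bot.2 hbot
  obtain ⟨c, hcV⟩ := exists_hasEigenvalue_of_isCompactOperator
    (isStarNormal_restrict hA hVA hVA') (hc.restrict' (f := A.toLinearMap) hVA)
  obtain ⟨x, hx⟩ := hcV.exists_hasEigenvector
  have hxA : (x : H) ∈ eigenspace A.toLinearMap c :=
    mem_eigenspace_iff.2 (congrArg Subtype.val hx.apply_eq_smul)
  have hxV : (x : H) ∈ V := Submodule.mem_iSup_of_mem c hxA
  exact hx.2 (Subtype.ext (inner_self_eq_zero.1 (x.2 _ hxV)))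

theorem exists_hilbertBasis_forall_mem {𝕜 E ι : Type*} [RCLike 𝕜] [NormedAddCommGroup E]
    [InnerProductSpace 𝕜 E] [CompleteSpace E] {V : ι → Submodule 𝕜 E} [∀ i, CompleteSpace (V i)]
    (hV : Pairwise fun i j => V i ⟂ V j) (hbot : (⨆ i, V i)ᗮ = ⊥) :
    ∃ (w : ∀ i, Set (V i)) (b : HilbertBasis (Σ i, w i) 𝕜 E), ∀ k, b k ∈ V k.1 := by
  choose w b _ using fun i => exists_hilbertBasis 𝕜 (V i)
  have hon : Orthonormal 𝕜 fun k : Σ i, w i => (b k.1 k.2 : E) :=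
    (OrthogonalFamily.of_pairwise hV).orthonormal_sigma_orthonormal fun i => (b i).orthonormal
  refine ⟨w, HilbertBasis.mkOfOrthogonalEqBot hon ?_, fun k => ?_⟩
  · rw [eq_bot_iff, ← hbot, ← Submodule.iInf_orthogonal]
    intro x hx
    refine (Submodule.mem_iInf _).2 fun i => Submodule.orthogonalProjectionOnto_eq_zero_iff.1 ?_
    refine (b i).repr.map_eq_zero_iff.1 (lp.ext (funext fun k => ?_))
    rw [(b i).repr_apply_apply, Submodule.inner_orthogonalProjectionOnto_eq_of_mem_left]
    exact hx _ (Submodule.subset_span ⟨⟨i, k⟩, rfl⟩)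
  · rw [HilbertBasis.coe_mkOfOrthogonalEqBot]
    exact (b k.1 k.2).2

theorem exists_hilbertBasis_eigenvectors (hA : IsStarNormal A) (hc : IsCompactOperator A) :
    ∃ (w : ∀ c, Set (eigenspace A.toLinearMap c)) (b : HilbertBasis (Σ c, w c) ℂ H),
      ∀ k, A (b k) = k.1 • b k := by
  obtain ⟨w, b, hb⟩ := exists_hilbertBasis_forall_mem (fun c d => isOrtho_eigenspace hA)
    (orthogonal_iSup_eigenspace_eq_bot hA hc)
  exact ⟨w, b, fun k => mem_eigenspace_iff.1 (hb k)⟩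

end CompactNormal

section SpectralDecomposition

theorem hasSum_smul_rankOne {𝕜 E ι : Type*} [RCLike 𝕜] [NormedAddCommGroup E]
    [InnerProductSpace 𝕜 E] [CompleteSpace E] (b : HilbertBasis ι 𝕜 E) {A : E →L[𝕜] E} {μ : ι → 𝕜}
    (hA : ∀ i, A (b i) = μ i • b i) (hμ : Summable fun i => ‖μ i‖) :
    HasSum (fun i => μ i • InnerProductSpace.rankOne 𝕜 (b i) (b i)) A := by
  have hsum : Summable fun i => μ i • InnerProductSpace.rankOne 𝕜 (b i) (b i) :=
    .of_norm (by simpa [norm_smul, b.orthonormal.1] using hμ)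
  convert hsum.hasSum
  ext x
  refine ((b.hasSum_repr x).mapL A).unique ?_
  convert! hsum.hasSum.mapL (ContinuousLinearMap.apply 𝕜 E x) using 2 with i
  rw [map_smul, hA, b.repr_apply_apply, smul_comm]
  rfl

theorem exists_isLowerSet_equiv (J : Type*) [Countable J] :
    ∃ I : Set ℕ, IsLowerSet I ∧ Nonempty (I ≃ J) := by
  rcases finite_or_infinite J with hJ | hJ
  · exact ⟨Set.Iio (Nat.card J), isLowerSet_Iio _,
      ⟨(Fin.equivSubtype (n := Nat.card J)).symm.trans (Finite.equivFin J).symm⟩⟩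
  · obtain ⟨hd⟩ := nonempty_denumerable J
    exact ⟨Set.univ, isLowerSet_univ, ⟨(Equiv.Set.univ ℕ).trans (Denumerable.eqv J).symm⟩⟩

theorem exists_isSpectralDecomposition_of_hasSum {H ι : Type*} [NormedAddCommGroup H]
    [InnerProductSpace ℂ H] {A : H →L[ℂ] H} {μ : ι → ℂ} {u : ι → H} (hu : Orthonormal ℂ u)
    (hμ : (Function.support μ).Countable)
    (hA : HasSum (fun i => μ i • InnerProductSpace.rankOne ℂ (u i) (u i)) A) :
    ∃ (I : Set ℕ) (ν : I → ℂ) (v : I → H), IsSpectralDecomposition A I ν v := by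
  have := hμ.to_subtype
  obtain ⟨I, hI, ⟨φ⟩⟩ := exists_isLowerSet_equiv (Function.support μ)
  refine ⟨I, fun n => μ (φ n), fun n => u (φ n), hI,
    hu.comp _ (Subtype.val_injective.comp φ.injective), fun n => (φ n).2, ?_⟩
  let F (i : ι) : H →L[ℂ] H := μ i • InnerProductSpace.rankOne ℂ (u i) (u i)
  have hsupport : Function.support F ⊆ Function.support μ := fun i hi hμi =>
    hi (by simp [F, show μ i = 0 from hμi])
  have hAμ : HasSum (F ∘ Subtype.val : Function.support μ → H →L[ℂ] H) A :=
    (hasSum_subtype_iff_of_support_subset hsupport).2 hA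
  exact (φ.hasSum_iff (f := F ∘ Subtype.val)).2 hAμ

theorem IsSpectralDecomposition.apply_eq_smul {H : Type*} [NormedAddCommGroup H]
    [InnerProductSpace ℂ H] {A : H →L[ℂ] H} {I : Set ℕ} {μ : I → ℂ} {u : I → H}
    (h : IsSpectralDecomposition A I μ u) (n : I) : A (u n) = μ n • u n := by
  refine (h.hasSum.mapL (ContinuousLinearMap.apply ℂ H (u n))).unique ?_
  convert hasSum_single n fun m hm => ?_
  · simp [h.orthonormal.1 n]
  · simp [h.orthonormal.2 hm]

variable {H : Type*} [NormedAddCommGroup H] [InnerProductSpace ℂ H] [CompleteSpace H]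

theorem MemSchatten.summable_norm_of_apply_eq_smul {A : H →L[ℂ] H} (hA : MemSchatten 1 A)
    {ι : Type*} {u : ι → H} (hu : Orthonormal ℂ u) {μ : ι → ℂ} (hAu : ∀ i, A (u i) = μ i • u i) :
    Summable fun i => ‖μ i‖ := by
  have hB := isBessel_of_orthonormal hu
  have hdiag (i : ι) : ⟪u i, A (u i)⟫_ℂ = μ i := by
    rw [hAu, inner_smul_right, inner_self_eq_norm_sq_to_K, hu.1 i]
    simp
  have hle : ∑' i, ‖μ i‖ₑ ≤ eTraceNorm A := by
    simpa only [hdiag] using hB.tsum_enorm_inner_le_eTraceNorm hB A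
  simpa using ENNReal.summable_toReal (hle.trans_lt (memSchatten_one_iff.1 hA)).ne

theorem MemSchatten.exists_isSpectralDecomposition {A : H →L[ℂ] H} (hA : MemSchatten 1 A)
    (hnormal : IsStarNormal A) :
    ∃ (I : Set ℕ) (μ : I → ℂ) (u : I → H), IsSpectralDecomposition A I μ u := by
  obtain ⟨w, b, hb⟩ := exists_hilbertBasis_eigenvectors hnormal hA.isCompactOperator
  have hsum := hA.summable_norm_of_apply_eq_smul b.orthonormal hb
  exact exists_isSpectralDecomposition_of_hasSum b.orthonormal
    (hsum.countable_support.mono fun _ hk => norm_ne_zero_iff.2 hk) (hasSum_smul_rankOne b hb hsum)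

theorem schattenNorm_nonneg (p : ℝ) (X : H →L[ℂ] H) : 0 ≤ schattenNorm p X :=
  Real.rpow_nonneg ENNReal.toReal_nonneg _

theorem ofReal_schattenNorm {p : ℝ} (hp : 0 ≤ p) {X : H →L[ℂ] H} (hX : MemSchatten p X) :
    ENNReal.ofReal (schattenNorm p X) = posTrace (CFC.abs X ^ p) ^ (1 / p) := by
  rw [schattenNorm, ← ENNReal.ofReal_rpow_of_nonneg ENNReal.toReal_nonneg (by positivity),
    ENNReal.ofReal_toReal hX.ne]

theorem ofReal_schattenNorm_one {X : H →L[ℂ] H} (hX : MemSchatten 1 X) :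
    ENNReal.ofReal (schattenNorm 1 X) = eTraceNorm X := by
  rw [ofReal_schattenNorm zero_le_one hX, posTrace_abs_rpow_one, one_div_one, ENNReal.rpow_one]

theorem IsSpectralDecomposition.eTraceNorm_sub_le {A₀ A : H →L[ℂ] H} {I : Set ℕ} {μ : I → ℂ}
    {u : I → H} (h : IsSpectralDecomposition A₀ I μ u) (hA : eTraceNorm A < ∞)
    (hle : eTraceNorm A ≤ eTraceNorm A₀) {p : ℝ} (hp : 1 ≤ p) (N : ℕ) :
    eTraceNorm (A₀ - A) ≤
      3 * ((N : ℝ≥0∞) ^ ((p - 1) / p) * posTrace (CFC.abs (A₀ - A) ^ p) ^ (1 / p)) +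
        2 * ∑' n : {n : I // N ≤ (n : ℕ)}, ‖μ n‖ₑ := by
  have hcard : ({n | N ≤ (n : ℕ)}ᶜ : Set I).encard ≤ N :=
    calc ({n | N ≤ (n : ℕ)}ᶜ : Set I).encard
        = (Subtype.val '' ({n | N ≤ (n : ℕ)}ᶜ : Set I)).encard :=
          (Subtype.val_injective.encard_image _).symm
      _ ≤ (Set.Iio N).encard :=
          Set.encard_le_encard (Set.image_subset_iff.2 fun n hn => by simpa using hn)
      _ = N := by simp [Set.encard_eq_coe_toFinset_card]
  have hbound := eTraceNorm_sub_le_of_hasSum h.orthonormal h.hasSum hA hle hp hcard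
  rwa [compl_compl] at hbound

theorem IsSpectralDecomposition.schattenNorm_sub_le {A₀ A : H →L[ℂ] H} {I : Set ℕ} {μ : I → ℂ}
    {u : I → H} (h : IsSpectralDecomposition A₀ I μ u) (hA₀ : MemSchatten 1 A₀)
    (hA : MemSchatten 1 A) (hle : schattenNorm 1 A ≤ schattenNorm 1 A₀) {p : ℝ} (hp : 1 ≤ p)
    (N : ℕ) : schattenNorm 1 (A₀ - A) ≤
      3 * (N : ℝ) ^ ((p - 1) / p) * schattenNorm p (A₀ - A) +
        2 * ∑' n : {n : I // N ≤ (n : ℕ)}, ‖μ n‖ := by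
  have hp₀ : 0 ≤ p := zero_le_one.trans hp
  have hp₁ : 0 ≤ (p - 1) / p := div_nonneg (sub_nonneg.2 hp) hp₀
  have hS := schattenNorm_nonneg p (A₀ - A)
  have hD := hA₀.sub hA
  have hle' : eTraceNorm A ≤ eTraceNorm A₀ := by
    simpa only [ofReal_schattenNorm_one, hA, hA₀] using ENNReal.ofReal_le_ofReal hle
  have htail : ENNReal.ofReal (∑' n : {n : I // N ≤ (n : ℕ)}, ‖μ n‖) =
      ∑' n : {n : I // N ≤ (n : ℕ)}, ‖μ n‖ₑ := by
    have hsum := hA₀.summable_norm_of_apply_eq_smul h.orthonormal h.apply_eq_smul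
    rw [ENNReal.ofReal_tsum_of_nonneg (fun _ => norm_nonneg _) (hsum.subtype _)]
    simp only [ofReal_norm]
  rw [← ENNReal.ofReal_le_ofReal_iff (by positivity),
    ENNReal.ofReal_add (by positivity) (by positivity), mul_assoc,
    ENNReal.ofReal_mul zero_le_three, ENNReal.ofReal_mul (by positivity),
    ENNReal.ofReal_mul zero_le_two, ← ENNReal.ofReal_rpow_of_nonneg N.cast_nonneg hp₁,
    ENNReal.ofReal_natCast, ENNReal.ofReal_ofNat, ENNReal.ofReal_ofNat,
    ofReal_schattenNorm_one hD, ofReal_schattenNorm hp₀ (hD.mono one_pos hp), htail]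
  exact h.eTraceNorm_sub_le (memSchatten_one_iff.1 hA) hle' hp N

end SpectralDecomposition

end Schatten

theorem theorem1_general {H : Type*} [NormedAddCommGroup H] [InnerProductSpace ℂ H]
    [CompleteSpace H] (p : ℝ) (hp : 1 ≤ p) (A₀ A : H →L[ℂ] H)
    (hA₀ : Schatten.MemSchatten 1 A₀) (hA : Schatten.MemSchatten 1 A)
    (hnormal : IsStarNormal A₀) (hle : Schatten.schattenNorm 1 A ≤ Schatten.schattenNorm 1 A₀) :
    Schatten.MemSchatten 1 (A₀ - A) ∧ Schatten.MemSchatten p (A₀ - A) ∧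
    (∃ (I : Set ℕ) (μ : I → ℂ) (u : I → H), Schatten.IsSpectralDecomposition A₀ I μ u) ∧
    ∀ (I : Set ℕ) (μ : I → ℂ) (u : I → H), Schatten.IsSpectralDecomposition A₀ I μ u →
      Summable (fun n => ‖μ n‖) ∧
      ∀ N : ℕ, Schatten.schattenNorm 1 (A₀ - A) ≤
        3 * (N : ℝ) ^ ((p - 1) / p) * Schatten.schattenNorm p (A₀ - A) +
          2 * ∑' n : {n : I // N ≤ (n : ℕ)}, ‖μ n‖ := by
  have hD : Schatten.MemSchatten 1 (A₀ - A) := hA₀.sub hA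
  refine ⟨hD, hD.mono one_pos hp, hA₀.exists_isSpectralDecomposition hnormal, fun I μ u h => ?_⟩
  exact ⟨hA₀.summable_norm_of_apply_eq_smul h.orthonormal h.apply_eq_smul,
    h.schattenNorm_sub_le hA₀ hA hle hp⟩

theorem theorem1 {H : Type*} [NormedAddCommGroup H] [InnerProductSpace ℂ H] [CompleteSpace H]
    (p : ℝ) (hp : 1 < p) (A₀ A : H →L[ℂ] H)
    (hA₀ : Schatten.MemSchatten 1 A₀) (hA : Schatten.MemSchatten 1 A)
    (hnormal : IsStarNormal A₀)
    (hnormA₀ : Schatten.schattenNorm 1 A₀ = 1) (hnormA : Schatten.schattenNorm 1 A = 1) :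
    Schatten.MemSchatten 1 (A₀ - A) ∧ Schatten.MemSchatten p (A₀ - A) ∧
    (∃ (I : Set ℕ) (μ : I → ℂ) (u : I → H), Schatten.IsSpectralDecomposition A₀ I μ u) ∧
    ∀ (I : Set ℕ) (μ : I → ℂ) (u : I → H), Schatten.IsSpectralDecomposition A₀ I μ u →
      Summable (fun n => ‖μ n‖) ∧
      ∀ N : ℕ, Schatten.schattenNorm 1 (A₀ - A) ≤
        3 * (N : ℝ) ^ ((p - 1) / p) * Schatten.schattenNorm p (A₀ - A) +
          2 * ∑' n : {n : I // N ≤ (n : ℕ)}, ‖μ n‖ :=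
  theorem1_general p hp.le A₀ A hA₀ hA hnormal (hnormA.trans hnormA₀.symm).le
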